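/- Let $d>1$ and $n\ge 2$ be integers, and work over $\mathbb{C}$. Let $\mu_d=\{\xi\in\mathbb{C}^*\mid \xi^d=1\}$ act on $\mathbb{A}^n$ by scalar multiplication, and let $A_{d,n}:=\mathbb{A}^n/\mu_d$ be the quotient, i.e. the affine variety with coordinate ring $\mathcal{O}(A_{d,n})=\mathbb{C}[x_1,\dots,x_n]^{\mu_d}$. Let $\mathrm{Aut}^{\mu_d}(\mathbb{A}^n)\subset\mathrm{Aut}(\mathbb{A}^n)$ be the (closed) subgroup of automorphisms commuting with every element of $\mu_d$, and let $\phi_d:\mathrm{Aut}^{\mu_d}(\mathbb{A}^n)\to\mathrm{Aut}(A_{d,n})$ be the natural homomorphism, which sends an automorphism to the one it induces on the quotient. For an affine variety $X$ the group $\mathrm{Aut}(X)$ carries its natural structure of an ind-group: if $V\subset\mathcal{O}(X)$ is a finite-dimensional subspace generating $\mathcal{O}(X)$ as an algebra and $F\subset\mathcal{O}(X)$ is finite-dimensional, then the automorphisms $g$ with $g^*(V)\subset F$ and $(g^{-1})^*(V)\subset F$ form a closed subvariety of $\mathrm{Hom}(V,F)^2$ via $g\mapsto(g^*|_V,(g^{-1})^*|_V)$,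 and these subvarieties give the filtration of $\mathrm{Aut}(X)$. A one-dimensional unipotent subgroup of $\mathrm{Aut}(X)$ (or of a closed subgroup of it) is a closed subgroup $U$ that is isomorphic, as an algebraic group, to the additive group $\mathbb{C}^+$. Then: 1. $\phi_d$ is surjective. 2. The kernel of $\phi_d$ is $\mu_d$, embedded in $\mathrm{Aut}^{\mu_d}(\mathbb{A}^n)$ as the group of scalar multiplications. 3. Every one-dimensional unipotent subgroup of $\mathrm{Aut}(A_{d,n})$ is the image under $\phi_d$ of some one-dimensional unipotent subgroup of $\mathrm{Aut}^{\mu_d}(\mathbb{A}^n)$. -/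

import Mathlib

noncomputable section

open Polynomial

/-! ### The ind-variety structure on the automorphism group of an affine variety

An affine variety `X` over `ℂ` is given by its coordinate ring `A = O(X)`, a finitely generated
`ℂ`-algebra.  An automorphism `g` of `X` is recorded by the `ℂ`-algebra automorphism
`f ↦ f ∘ g⁻¹` of `A`; this is a group isomorphism `Aut(X) ≅ (A ≃ₐ[ℂ] A)`. -/

namespace AffAut

variable {A : Type*} [CommRing A] [Algebra ℂ A]

/-- `V` is a finite-dimensional subspace that generates `A` as a `ℂ`-algebra, i.e. it corresponds
to a closed embedding of `X` into the affine space `V^*`. -/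
def Generating (V : Submodule ℂ A) : Prop :=
  FiniteDimensional ℂ V ∧ Algebra.adjoin ℂ (V : Set A) = ⊤

/-- The pieces `{g | g(V) ⊆ F, g⁻¹(V) ⊆ F}` of the natural filtration of `Aut(X)`.
For `V` generating and `F` finite-dimensional, `g ↦ (g|_V, g⁻¹|_V)` identifies the piece with a
Zariski closed subset of the finite-dimensional vector space `Hom(V, F) × Hom(V, F)`; this is its
structure of an affine variety.  For fixed `V` the pieces, with `F` running through an exhausting
ascending sequence of finite-dimensional subspaces, form the filtration of the ind-variety
`Aut(X)`, and different choices of `V` and of the sequence give equivalent filtrations. -/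
def piece (V F : Submodule ℂ A) : Set (A ≃ₐ[ℂ] A) :=
  {g | ∀ v ∈ V, g v ∈ F ∧ g.symm v ∈ F}

/-- Polynomials in the matrix coefficients `g ↦ ℓ (g a)` and `g ↦ ℓ (g⁻¹ a)`, where `a ∈ A` and `ℓ`
is a linear form on `A`.  Since `V` generates `A`, the restrictions of these functions to
`piece V F` are exactly the restrictions of the polynomial functions on `Hom(V, F) × Hom(V, F)`,
that is, the regular functions on the affine variety `piece V F`. -/
def coeffAlgebra (A : Type*) [CommRing A] [Algebra ℂ A] : Subalgebra ℂ ((A ≃ₐ[ℂ] A) → ℂ) :=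
  Algebra.adjoin ℂ
    {c | ∃ (a : A) (l : A →ₗ[ℂ] ℂ), c = (fun g => l (g a)) ∨ c = (fun g => l (g.symm a))}

/-- Closed subsets of the ind-variety `Aut(X)`: the intersection with every piece of the
filtration is the zero set of regular functions in that piece. -/
def IsIndClosed (S : Set (A ≃ₐ[ℂ] A)) : Prop :=
  ∀ V F : Submodule ℂ A, Generating V → FiniteDimensional ℂ F →
    ∃ E : Set ((A ≃ₐ[ℂ] A) → ℂ), E ⊆ coeffAlgebra A ∧
      S ∩ piece V F = {g | g ∈ piece V F ∧ ∀ r ∈ E, r g = 0}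

/-- A map `ℂ → Aut(X)` is a morphism of ind-varieties: it takes values in one piece of the
filtration, and it pulls regular functions back to polynomials. -/
def IsMorphismFromLine (e : ℂ → (A ≃ₐ[ℂ] A)) : Prop :=
  (∃ V F : Submodule ℂ A, Generating V ∧ FiniteDimensional ℂ F ∧ ∀ s, e s ∈ piece V F) ∧
    ∀ r ∈ coeffAlgebra A, ∃ p : ℂ[X], ∀ s : ℂ, r (e s) = p.eval s

/-- A function on a closed subset `S` of `Aut(X)` is a morphism of ind-varieties `S → ℂ`: on the
intersection of `S` with every piece it is the restriction of a regular function. -/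
def IsMorphismToLine (S : Set (A ≃ₐ[ℂ] A)) (t : S → ℂ) : Prop :=
  ∀ V F : Submodule ℂ A, Generating V → FiniteDimensional ℂ F →
    ∃ r ∈ coeffAlgebra A, ∀ u : S, (u : A ≃ₐ[ℂ] A) ∈ piece V F → t u = r u

/-- A one-dimensional unipotent subgroup of `Aut(X)`: a closed subgroup `U` that is isomorphic to
the additive group `ℂ⁺`, by a group isomorphism that is an isomorphism of ind-varieties. -/
def IsOneDimUnipotent (U : Subgroup (A ≃ₐ[ℂ] A)) : Prop :=
  IsIndClosed (U : Set (A ≃ₐ[ℂ] A)) ∧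
    ∃ e : Multiplicative ℂ ≃* U,
      IsMorphismFromLine (fun s : ℂ => (e (Multiplicative.ofAdd s) : A ≃ₐ[ℂ] A)) ∧
      IsMorphismToLine (U : Set (A ≃ₐ[ℂ] A)) (fun u => Multiplicative.toAdd (e.symm u))

/-! ### Quotients by a group of automorphisms -/

/-- `Aut^H(X)`: the automorphisms of `X` that commute with every element of `H`. -/
def equivariant (H : Subgroup (A ≃ₐ[ℂ] A)) : Subgroup (A ≃ₐ[ℂ] A) :=
  Subgroup.centralizer (H : Set (A ≃ₐ[ℂ] A))

/-- `O(X / H) = O(X)^H`, the algebra of invariants. -/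
def invariants (H : Subgroup (A ≃ₐ[ℂ] A)) : Subalgebra ℂ A where
  carrier := {f | ∀ h ∈ H, h f = f}
  mul_mem' := fun ha hb h hh => by rw [map_mul, ha h hh, hb h hh]
  add_mem' := fun ha hb h hh => by rw [map_add, ha h hh, hb h hh]
  algebraMap_mem' := fun c h _ => h.commutes c

theorem equivariant_apply_mem {H : Subgroup (A ≃ₐ[ℂ] A)} {g : A ≃ₐ[ℂ] A}
    (hg : g ∈ equivariant H) {f : A} (hf : f ∈ invariants H) : g f ∈ invariants H := by
  intro h hh
  have h1 : h * g = g * h := Subgroup.mem_centralizer_iff.mp hg h hh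
  calc h (g f) = (h * g) f := rfl
    _ = g (h f) := by rw [h1]; rfl
    _ = g f := by rw [hf h hh]

/-- The natural homomorphism `Aut^H(X) → Aut(X / H)`: restriction to the invariants. -/
def quotientHom (H : Subgroup (A ≃ₐ[ℂ] A)) :
    equivariant H →* (invariants H ≃ₐ[ℂ] invariants H) where
  toFun g := AlgEquiv.ofAlgHom
    (((g : A ≃ₐ[ℂ] A).toAlgHom.comp (invariants H).val).codRestrict (invariants H)
      fun f => equivariant_apply_mem g.2 f.2)
    (((g⁻¹ : equivariant H) : A ≃ₐ[ℂ] A).toAlgHom.comp (invariants H).val |>.codRestrict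
      (invariants H) fun f => equivariant_apply_mem (g⁻¹).2 f.2)
    (by ext f; exact (g : A ≃ₐ[ℂ] A).apply_symm_apply f)
    (by ext f; exact (g : A ≃ₐ[ℂ] A).symm_apply_apply f)
  map_one' := by ext f; rfl
  map_mul' g g' := by ext f; rfl

end AffAut

/-! ### The action of `μ_d` on affine space by scalar multiplication -/

/-- The algebra endomorphism `f ↦ f (c x)` of `ℂ[x_1, …, x_n]`. -/
def scalarHom (n : ℕ) (c : ℂ) : MvPolynomial (Fin n) ℂ →ₐ[ℂ] MvPolynomial (Fin n) ℂ :=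
  MvPolynomial.aeval fun i => MvPolynomial.C c * MvPolynomial.X i

theorem scalarHom_one (n : ℕ) : scalarHom n 1 = AlgHom.id ℂ _ := by
  refine MvPolynomial.algHom_ext fun i => ?_
  rw [scalarHom, MvPolynomial.aeval_X, map_one, one_mul, AlgHom.id_apply]

theorem scalarHom_comp (n : ℕ) (b c : ℂ) :
    (scalarHom n b).comp (scalarHom n c) = scalarHom n (b * c) := by
  refine MvPolynomial.algHom_ext fun i => ?_
  rw [AlgHom.comp_apply, scalarHom, scalarHom, scalarHom, MvPolynomial.aeval_X,
    MvPolynomial.aeval_X, map_mul, MvPolynomial.aeval_X, MvPolynomial.algHom_C,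
    MvPolynomial.algebraMap_eq, map_mul]
  ring

/-- Scalar multiplication by `c` on `𝔸^n`, acting on functions by `f ↦ f (c⁻¹ x)`. -/
def scalarAut (n : ℕ) : ℂˣ →* (MvPolynomial (Fin n) ℂ ≃ₐ[ℂ] MvPolynomial (Fin n) ℂ) where
  toFun c := AlgEquiv.ofAlgHom (scalarHom n ((c⁻¹ : ℂˣ) : ℂ)) (scalarHom n (c : ℂ))
    (by rw [scalarHom_comp, Units.inv_mul, scalarHom_one])
    (by rw [scalarHom_comp, Units.mul_inv, scalarHom_one])
  map_one' := AlgEquiv.ext fun f => by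
    change scalarHom n ((1⁻¹ : ℂˣ) : ℂ) f = f
    rw [inv_one, Units.val_one, scalarHom_one, AlgHom.id_apply]
  map_mul' b c := AlgEquiv.ext fun f => by
    change scalarHom n (((b * c)⁻¹ : ℂˣ) : ℂ) f =
      scalarHom n ((b⁻¹ : ℂˣ) : ℂ) (scalarHom n ((c⁻¹ : ℂˣ) : ℂ) f)
    rw [mul_inv, Units.val_mul, ← scalarHom_comp, AlgHom.comp_apply]

/-- The image of `μ_d = {ξ ∈ ℂ^* | ξ^d = 1}` in `Aut(𝔸^n)`. -/
def muSubgroup (d n : ℕ) :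
    Subgroup (MvPolynomial (Fin n) ℂ ≃ₐ[ℂ] MvPolynomial (Fin n) ℂ) :=
  (rootsOfUnity d ℂ).map (scalarAut n)

/-- `Aut^{μ_d}(𝔸^n)`. -/
abbrev AutMu (d n : ℕ) : Subgroup (MvPolynomial (Fin n) ℂ ≃ₐ[ℂ] MvPolynomial (Fin n) ℂ) :=
  AffAut.equivariant (muSubgroup d n)

/-- The coordinate ring `O(A_{d,n}) = ℂ[x_1, …, x_n]^{μ_d}` of `A_{d,n} = 𝔸^n / μ_d`. -/
abbrev CoordRing (d n : ℕ) : Subalgebra ℂ (MvPolynomial (Fin n) ℂ) :=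
  AffAut.invariants (muSubgroup d n)

/-- The natural homomorphism `φ_d : Aut^{μ_d}(𝔸^n) → Aut(A_{d,n})`. -/
def phi (d n : ℕ) : AutMu d n →* (CoordRing d n ≃ₐ[ℂ] CoordRing d n) :=
  AffAut.quotientHom (muSubgroup d n)

/-- The embedding of `μ_d` into `Aut^{μ_d}(𝔸^n)` by scalar multiplications. -/
def muHom (d n : ℕ) : rootsOfUnity d ℂ →* AutMu d n :=
  ((scalarAut n).comp (rootsOfUnity d ℂ).subtype).codRestrict (AutMu d n) (by
    intro c
    refine Subgroup.mem_centralizer_iff.mpr ?_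
    rintro _ ⟨c', _, rfl⟩
    change scalarAut n c' * scalarAut n c = scalarAut n c * scalarAut n c'
    rw [← map_mul, ← map_mul, mul_comm])

end

noncomputable section

open scoped Polynomial

/-! ### Perfect powers in factorial rings -/

section Powers

/-! Everything rests on the relation `(x_i^(d-1) x_j)^d = (x_i^d)^(d-1) x_j^d` between invariants.
Let `g` be a homomorphism from the invariants to a factorial `ℂ`-domain. If `g(x_i^d) = y^d ≠ 0`,
then `x_j ↦ g(x_i^(d-1) x_j) / y^(d-1)` extends `g` to all polynomials. Such a `y` exists when units
are `d`-th powers and no prime divides all `g(x_j^d)`: for a prime not dividing `g(x_j^d)`, the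
relation gives `d * v(g(x_i^(d-1) x_j)) = (d-1) * v(g(x_i^d))`, hence `d ∣ v(g(x_i^d))`
(`exists_aeval_eq`).

For an automorphism of the quotient the prime condition is geometric: the common zeros of the
`g(x_j^d)` lie over one point of the quotient, so they form a finite set, which contains no
hypersurface as `n ≥ 2` (`isUnit_of_forall_dvd`). Lifts are unique up to `μ_d`
(`exists_smul_of_eqOn`); this yields the kernel and the bijectivity of lifts, and a look at linear
terms shows that lifts commute with `μ_d`.

For unipotent subgroups the same extension result is applied over `ℂ[x_1, …, x_n][s]`, so a whole
one-parameter family lifts at once. The group law can fail only by a root of unity independent of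
`s`, which is `1` after normalising at `s = 0`. The image is closed because the regular coordinate
on `U` pulls back to a regular left inverse of the lifted parametrization
(`isOneDimUnipotent_range`). -/

theorem exists_associated_pow_of_dvd_emultiplicity {R : Type*} [CommMonoidWithZero R]
    [UniqueFactorizationMonoid R] {d : ℕ} (hd : d ≠ 0) (x : R)
    (hx : ∀ p : R, Prime p → ∀ k : ℕ, emultiplicity p x = k → d ∣ k) :
    ∃ y, Associated (y ^ d) x := by
  induction x using UniqueFactorizationMonoid.induction_on_coprime with
  | h0 => exact ⟨0, by rw [zero_pow hd]⟩
  | h1 hu => exact ⟨1, by rw [one_pow]; exact (associated_one_iff_isUnit.mpr hu).symm⟩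
  | hpr i hp =>
    obtain ⟨k, rfl⟩ := hx _ hp i (emultiplicity_pow_self_of_prime hp i)
    exact ⟨_ ^ k, by rw [← pow_mul, mul_comm k d]⟩
  | hcp hxy ihx ihy =>
    rename_i x y
    -- A prime dividing one of two coprime factors has the same multiplicity in that factor as in
    -- the product.
    have key : ∀ a b : R, IsRelPrime a b →
        (∀ p : R, Prime p → ∀ k : ℕ, emultiplicity p (a * b) = k → d ∣ k) →
        ∀ p : R, Prime p → ∀ k : ℕ, emultiplicity p a = k → d ∣ k := by
      intro a b hab h p hp k hk
      by_cases hpa : p ∣ a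
      · refine h p hp k ?_
        have hpb : ¬ p ∣ b := fun hpb => hp.not_isUnit (hab hpa hpb)
        rw [emultiplicity_mul hp, emultiplicity_eq_zero.mpr hpb, add_zero, hk]
      · rw [emultiplicity_eq_zero.mpr hpa] at hk
        have : k = 0 := by exact_mod_cast hk.symm
        simp [this]
    obtain ⟨u, hu⟩ := ihx (key x y hxy hx)
    obtain ⟨v, hv⟩ := ihy (key y x hxy.symm (by simpa only [mul_comm] using hx))
    exact ⟨u * v, by rw [mul_pow]; exact hu.mul_mul hv⟩

/-- In a domain over `ℂ`, two elements with the same `d`-th power differ by a `d`-th root of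
unity in `ℂ`. -/
theorem exists_eq_smul_of_pow_eq_pow {R : Type*} [CommRing R] [IsDomain R] [Algebra ℂ R] {d : ℕ}
    (hd : d ≠ 0) {x y : R} (h : x ^ d = y ^ d) : ∃ c : ℂ, c ^ d = 1 ∧ x = c • y := by
  have hζ := Complex.isPrimitiveRoot_exp d hd
  have hζR := hζ.map_of_injective (algebraMap ℂ R).injective
  have h0 := hζR.pow_sub_pow_eq_prod_sub_mul x y (Nat.pos_of_ne_zero hd)
  rw [h, sub_self, eq_comm, Finset.prod_eq_zero_iff] at h0
  obtain ⟨η, hη, hxy⟩ := h0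
  rw [Polynomial.mem_nthRootsFinset (Nat.pos_of_ne_zero hd)] at hη
  have : NeZero d := ⟨hd⟩
  obtain ⟨k, -, rfl⟩ := hζR.eq_pow_of_pow_eq_one hη
  refine ⟨Complex.exp (2 * Real.pi * Complex.I / d) ^ k, ?_, ?_⟩
  · rw [← pow_mul, mul_comm k, pow_mul, hζ.pow_eq_one, one_pow]
  · rw [Algebra.smul_def, map_pow]
    exact sub_eq_zero.mp hxy

end Powers

/-! ### Scalar multiplications and the invariants -/

theorem scalarHom_monomial {n : ℕ} (c : ℂ) (m : Fin n →₀ ℕ) (a : ℂ) :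
    scalarHom n c (MvPolynomial.monomial m a) = MvPolynomial.monomial m (c ^ m.degree * a) := by
  rw [scalarHom, MvPolynomial.aeval_monomial, MvPolynomial.monomial_eq, Finsupp.prod, Finsupp.prod,
    Finsupp.degree_apply]
  simp only [mul_pow, Finset.prod_mul_distrib, ← map_pow, ← map_prod]
  rw [Finset.prod_pow_eq_pow_sum, MvPolynomial.algebraMap_eq, map_mul]
  ring

theorem coeff_scalarHom {n : ℕ} (c : ℂ) (f : MvPolynomial (Fin n) ℂ) (m : Fin n →₀ ℕ) :
    (scalarHom n c f).coeff m = c ^ m.degree * f.coeff m := by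
  induction f using MvPolynomial.induction_on' with
  | monomial u a =>
    rw [scalarHom_monomial, MvPolynomial.coeff_monomial, MvPolynomial.coeff_monomial]
    split_ifs with h
    · rw [h]
    · rw [mul_zero]
  | add p q hp hq => rw [map_add, MvPolynomial.coeff_add, MvPolynomial.coeff_add, hp, hq, mul_add]

theorem scalarHom_X {n : ℕ} (c : ℂ) (j : Fin n) :
    scalarHom n c (MvPolynomial.X j) = c • MvPolynomial.X j := by
  rw [scalarHom, MvPolynomial.aeval_X, MvPolynomial.C_mul']

theorem mem_coordRing_iff_scalarHom {d n : ℕ} (hd : d ≠ 0) {f : MvPolynomial (Fin n) ℂ} :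
    f ∈ CoordRing d n ↔ ∀ c : ℂ, c ^ d = 1 → scalarHom n c f = f := by
  constructor
  · intro hf c hc
    have hc0 : c ≠ 0 := by rintro rfl; simp [hd] at hc
    refine hf (scalarAut n (Units.mk0 c hc0)⁻¹) ⟨_, ?_, rfl⟩
    refine inv_mem ((mem_rootsOfUnity _ _).mpr (Units.ext ?_))
    simpa using hc
  · rintro hf _ ⟨c, hc, rfl⟩
    refine hf _ ?_
    have := (mem_rootsOfUnity _ _).mp (inv_mem hc)
    simpa using congrArg Units.val this

theorem mem_coordRing_iff {d n : ℕ} (hd : d ≠ 0) {f : MvPolynomial (Fin n) ℂ} :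
    f ∈ CoordRing d n ↔ ∀ m, f.coeff m ≠ 0 → d ∣ m.degree := by
  rw [mem_coordRing_iff_scalarHom hd]
  constructor
  · intro hf m hm
    have hζ := Complex.isPrimitiveRoot_exp d hd
    have h := congrArg (MvPolynomial.coeff m) (hf _ hζ.pow_eq_one)
    rw [coeff_scalarHom] at h
    exact hζ.dvd_of_pow_eq_one _ (mul_right_cancel₀ hm (by rw [h, one_mul]))
  · intro hf c hc
    ext m
    rw [coeff_scalarHom]
    by_cases hm : f.coeff m = 0
    · rw [hm, mul_zero]
    · obtain ⟨k, hk⟩ := hf m hm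
      rw [hk, pow_mul, hc, one_pow, one_mul]

section Invariants

variable {d n : ℕ}

/-- The monomials of degree divisible by `d`, as invariants. -/
def invMonomial (hd : d ≠ 0) (m : Fin n →₀ ℕ) (h : d ∣ m.degree) : CoordRing d n :=
  ⟨MvPolynomial.monomial m 1, (mem_coordRing_iff hd).mpr fun m' hm' => by
    rw [MvPolynomial.coeff_monomial] at hm'
    by_cases hmm : m = m'
    · exact hmm ▸ h
    · exact absurd (if_neg hmm) hm'⟩

theorem exists_eq_sum_invMonomial (hd : d ≠ 0) (f : CoordRing d n) :
    f = ∑ m ∈ (f : MvPolynomial (Fin n) ℂ).support.attach,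
      (f : MvPolynomial (Fin n) ℂ).coeff m • invMonomial hd m
        ((mem_coordRing_iff hd).mp f.2 m (MvPolynomial.mem_support_iff.mp m.2)) := by
  apply Subtype.ext
  rw [AddSubmonoidClass.coe_finsetSum]
  conv_lhs => rw [MvPolynomial.as_sum (f : MvPolynomial (Fin n) ℂ), ← Finset.sum_attach]
  refine Finset.sum_congr rfl fun m _ => ?_
  rw [SetLike.val_smul, invMonomial, MvPolynomial.smul_monomial, smul_eq_mul, mul_one]

/-- The invariant `x_i ^ (d - 1) * x_j`. -/
def mixedPower (hd : d ≠ 0) (i j : Fin n) : CoordRing d n :=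
  ⟨MvPolynomial.X i ^ (d - 1) * MvPolynomial.X j, (mem_coordRing_iff_scalarHom hd).mpr
    fun c hc => by
      rw [map_mul, map_pow, scalarHom_X, scalarHom_X, smul_pow, smul_mul_smul_comm, ← pow_succ,
        Nat.sub_one_add_one hd, hc, one_smul]⟩

/-- The invariant `x_j ^ d`. -/
def purePower (hd : d ≠ 0) (j : Fin n) : CoordRing d n :=
  ⟨MvPolynomial.X j ^ d, (mem_coordRing_iff_scalarHom hd).mpr fun c hc => by
    rw [map_pow, scalarHom_X, smul_pow, hc, one_smul]⟩

theorem purePower_ne_zero (hd : d ≠ 0) (j : Fin n) : purePower hd j ≠ 0 := fun h =>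
  pow_ne_zero d (MvPolynomial.X_ne_zero (R := ℂ) j) (congrArg Subtype.val h)

theorem mixedPower_self (hd : d ≠ 0) (i : Fin n) : mixedPower hd i i = purePower hd i :=
  Subtype.ext (by
    change MvPolynomial.X i ^ (d - 1) * MvPolynomial.X i = MvPolynomial.X i ^ d
    rw [← pow_succ, Nat.sub_one_add_one hd])

theorem mixedPower_pow (hd : d ≠ 0) (i j : Fin n) :
    mixedPower hd i j ^ d = purePower hd i ^ (d - 1) * purePower hd j :=
  Subtype.ext (by
    change (MvPolynomial.X i ^ (d - 1) * MvPolynomial.X j) ^ d =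
      (MvPolynomial.X i ^ d) ^ (d - 1) * MvPolynomial.X j ^ d
    rw [mul_pow, ← pow_mul, ← pow_mul, mul_comm (d - 1)])

theorem invMonomial_pow (hd : d ≠ 0) (m : Fin n →₀ ℕ) (h : d ∣ m.degree) :
    invMonomial hd m h ^ d = ∏ j, purePower hd j ^ m j :=
  Subtype.ext (by
    rw [SubmonoidClass.coe_pow, SubmonoidClass.coe_finsetProd]
    change MvPolynomial.monomial m (1 : ℂ) ^ d =
      ∏ j, (((purePower hd j ^ m j : CoordRing d n)) : MvPolynomial (Fin n) ℂ)
    rw [MvPolynomial.monomial_eq, map_one, one_mul, Finsupp.prod_fintype _ _ (by simp),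
      ← Finset.prod_pow]
    refine Finset.prod_congr rfl fun j _ => ?_
    change _ = (MvPolynomial.X j ^ d) ^ m j
    rw [← pow_mul, ← pow_mul, mul_comm])

/-- After `x_i^d` is inverted, the mixed powers with this fixed `i` generate all invariants, so they
determine a homomorphism not killing `x_i^d`. -/
theorem invMonomial_mul (hd : d ≠ 0) (i : Fin n) (m : Fin n →₀ ℕ) (k : ℕ)
    (h : m.degree = d * k) :
    invMonomial hd m ⟨k, h⟩ * purePower hd i ^ ((d - 1) * k) =
      ∏ j, mixedPower hd i j ^ m j :=
  Subtype.ext (by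
    rw [SubmonoidClass.coe_finsetProd]
    change MvPolynomial.monomial m (1 : ℂ) * (MvPolynomial.X i ^ d) ^ ((d - 1) * k) =
      ∏ j, (MvPolynomial.X i ^ (d - 1) * MvPolynomial.X j) ^ m j
    simp only [mul_pow, Finset.prod_mul_distrib]
    rw [Finset.prod_pow_eq_pow_sum, MvPolynomial.monomial_eq, map_one, one_mul,
      Finsupp.prod_fintype _ _ (by simp), ← Finsupp.degree_eq_sum, h, ← pow_mul, ← pow_mul,
      mul_comm]
    congr 2
    ring)

/-! ### Extending homomorphisms from the invariants to all polynomials -/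

variable {R : Type*} [CommRing R] [IsDomain R] [Algebra ℂ R]

theorem aeval_eq_of_mixedPower (hd : d ≠ 0) (g : CoordRing d n →ₐ[ℂ] R) (h : Fin n → R) (i : Fin n)
    (hi : h i ≠ 0) (hg : ∀ j, g (mixedPower hd i j) = h i ^ (d - 1) * h j) (a : CoordRing d n) :
    MvPolynomial.aeval h (a : MvPolynomial (Fin n) ℂ) = g a := by
  have hmon : ∀ m hm, MvPolynomial.aeval h
      ((invMonomial hd m hm : CoordRing d n) : MvPolynomial (Fin n) ℂ) =
      g (invMonomial hd m hm) := by
    rintro m ⟨k, hk⟩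
    have h1 := congrArg g (invMonomial_mul hd i m k hk)
    rw [map_mul, map_pow, ← mixedPower_self, hg, map_prod] at h1
    simp only [map_pow, hg, mul_pow, Finset.prod_mul_distrib] at h1
    rw [Finset.prod_pow_eq_pow_sum, ← mul_pow, ← pow_succ,
      Nat.sub_one_add_one hd, ← pow_mul, ← pow_mul, ← Finsupp.degree_eq_sum] at h1
    have h2 : h i ^ (d * ((d - 1) * k)) ≠ 0 := pow_ne_zero _ hi
    have h3 : (d - 1) * m.degree = d * ((d - 1) * k) := by rw [hk]; ring
    rw [h3, mul_comm] at h1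
    rw [mul_left_cancel₀ h2 h1]
    change MvPolynomial.aeval h (MvPolynomial.monomial m 1) = _
    rw [MvPolynomial.aeval_monomial, map_one, one_mul, Finsupp.prod_fintype _ _ (by simp)]
  conv_lhs => rw [exists_eq_sum_invMonomial hd a]
  conv_rhs => rw [exists_eq_sum_invMonomial hd a]
  rw [AddSubmonoidClass.coe_finsetSum, map_sum, map_sum]
  refine Finset.sum_congr rfl fun m _ => ?_
  rw [SetLike.val_smul, map_smul, map_smul, hmon]

/-- The valuation argument makes `g(x_i^d)` a `d`-th power up to a unit. The target `R` is kept
general to cover both single automorphisms and polynomial families of them. -/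
theorem exists_aeval_eq [UniqueFactorizationMonoid R] (hd : d ≠ 0)
    (hR : ∀ u : R, IsUnit u → ∃ v, v ^ d = u)
    (g : CoordRing d n →ₐ[ℂ] R) (i : Fin n) (hi : g (purePower hd i) ≠ 0)
    (hg : ∀ p : R, Prime p → ∃ j, ¬ p ∣ g (purePower hd j)) :
    ∃ H : MvPolynomial (Fin n) ℂ →ₐ[ℂ] R, ∀ a : CoordRing d n, H a = g a := by
  have hpow : ∃ y, y ^ d = g (purePower hd i) := by
    obtain ⟨y, u, hy⟩ := exists_associated_pow_of_dvd_emultiplicity hd (g (purePower hd i)) (by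
      intro p hp k hk
      obtain ⟨j, hj⟩ := hg p hp
      have h1 := congrArg (fun a => emultiplicity p (g a)) (mixedPower_pow hd i j)
      simp only [map_mul, map_pow] at h1
      rw [emultiplicity_pow hp, emultiplicity_mul hp, emultiplicity_pow hp, hk,
        emultiplicity_eq_zero.mpr hj, add_zero] at h1
      have hz : g (mixedPower hd i j) ≠ 0 := by
        intro h0
        have h2 := congrArg g (mixedPower_pow hd i j)
        rw [map_mul, map_pow, map_pow, h0, zero_pow hd, eq_comm] at h2
        rcases mul_eq_zero.mp h2 with h3 | h3
        · exact pow_ne_zero _ hi h3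
        · exact hj (h3 ▸ dvd_zero p)
      rw [(FiniteMultiplicity.of_prime_left hp hz).emultiplicity_eq_multiplicity] at h1
      have h2 : d * multiplicity p (g (mixedPower hd i j)) = (d - 1) * k := by exact_mod_cast h1
      have hcop : Nat.Coprime d (d - 1) := by
        rw [Nat.coprime_comm]
        exact (Nat.coprime_self_sub_right (Nat.one_le_iff_ne_zero.mpr hd)).mpr
          (Nat.coprime_one_right d) |>.symm
      exact hcop.dvd_of_dvd_mul_left ⟨_, h2.symm⟩)
    obtain ⟨v, hv⟩ := hR u u.isUnit
    exact ⟨y * v, by rw [mul_pow, hv, hy]⟩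
  obtain ⟨y, hy⟩ := hpow
  have hy0 : y ≠ 0 := by rintro rfl; rw [zero_pow hd] at hy; exact hi hy.symm
  -- Divisibility may be tested on `d`-th powers, since a factorial ring is integrally closed.
  have hdvd : ∀ j, y ^ (d - 1) ∣ g (mixedPower hd i j) := fun j => by
    rw [← IsIntegrallyClosed.pow_dvd_pow_iff hd, ← map_pow, mixedPower_pow, map_mul, map_pow, ← hy,
      ← pow_mul, ← pow_mul, mul_comm (d - 1)]
    exact dvd_mul_right _ _
  choose h hh using hdvd
  have hyi : h i = y := by
    have := hh i
    rw [mixedPower_self, ← hy, ← Nat.sub_one_add_one hd, pow_succ, Nat.add_sub_cancel] at this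
    exact (mul_left_cancel₀ (pow_ne_zero _ hy0) this).symm
  exact ⟨MvPolynomial.aeval h, aeval_eq_of_mixedPower hd g h i (by rwa [hyi])
    (fun j => by rw [hyi, hh])⟩

/-- Two extensions of the same homomorphism differ by a scalar multiplication in `μ_d`. -/
theorem exists_smul_of_eqOn (hd : d ≠ 0) (H H' : MvPolynomial (Fin n) ℂ →ₐ[ℂ] R)
    (hH : ∀ a : CoordRing d n, H a = H' a) (i : Fin n) (hi : H (MvPolynomial.X i) ≠ 0) :
    ∃ c : ℂ, c ^ d = 1 ∧ H' = H.comp (scalarHom n c) := by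
  have h1 := hH (purePower hd i)
  change H (MvPolynomial.X i ^ d) = H' (MvPolynomial.X i ^ d) at h1
  rw [map_pow, map_pow] at h1
  obtain ⟨c, hc, hx⟩ := exists_eq_smul_of_pow_eq_pow hd h1.symm
  refine ⟨c, hc, MvPolynomial.algHom_ext fun j => ?_⟩
  have h2 := hH (mixedPower hd i j)
  change H (MvPolynomial.X i ^ (d - 1) * MvPolynomial.X j) =
    H' (MvPolynomial.X i ^ (d - 1) * MvPolynomial.X j) at h2
  rw [map_mul, map_pow, map_mul, map_pow, hx, smul_pow, smul_mul_assoc, ← mul_smul_comm] at h2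
  -- This reads `H x_j = c^(d-1) • H' x_j`; multiplying by `c` and using `c^d = 1` gives the claim.
  have h3 := mul_left_cancel₀ (pow_ne_zero _ hi) h2
  rw [AlgHom.comp_apply, scalarHom_X, map_smul, h3, smul_smul, ← pow_succ',
    Nat.sub_one_add_one hd, hc, one_smul]

end Invariants

/-! ### Automorphisms of the quotient lift to affine space -/

section Lifting

variable {d n : ℕ}

/-- A divisor of a nonzero polynomial in one variable involves no other variable; applied to two
different variables, this leaves only nonzero constants. -/
theorem isUnit_of_dvd_X_pow_sub_C {σ : Type*} {i j : σ} (hij : i ≠ j) {d : ℕ} (hd : d ≠ 0)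
    {q : MvPolynomial σ ℂ} {b c : ℂ} (hi : q ∣ MvPolynomial.X i ^ d - MvPolynomial.C b)
    (hj : q ∣ MvPolynomial.X j ^ d - MvPolynomial.C c) : IsUnit q := by
  classical
  have hne : ∀ (k : σ) (a : ℂ), MvPolynomial.X k ^ d - MvPolynomial.C a ≠ 0 := by
    intro k a h
    have h1 := congrArg (MvPolynomial.eval fun _ => (0 : ℂ)) h
    have h2 := congrArg (MvPolynomial.eval fun _ => (1 : ℂ)) h
    simp [hd] at h1 h2
    simp [h1] at h2
  have hdeg : ∀ (k l : σ) (a : ℂ), k ≠ l → q ∣ MvPolynomial.X k ^ d - MvPolynomial.C a →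
      q.degreeOf l = 0 := by
    rintro k l a hkl ⟨r, hr⟩
    have h0 := hne k a
    have hq : q ≠ 0 := by rintro rfl; rw [zero_mul] at hr; exact h0 hr
    have hr0 : r ≠ 0 := by rintro rfl; rw [mul_zero] at hr; exact h0 hr
    have h1 := MvPolynomial.degreeOf_mul_eq (n := l) hq hr0
    rw [← hr] at h1
    have h2 : (MvPolynomial.X k ^ d - MvPolynomial.C a : MvPolynomial σ ℂ).degreeOf l ≤ 0 := by
      refine (MvPolynomial.degreeOf_sub_le _ _ _).trans (max_le ?_ ?_)
      · refine (MvPolynomial.degreeOf_pow_le _ _ _).trans ?_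
        rw [MvPolynomial.degreeOf_X_of_ne hkl.symm, mul_zero]
      · rw [MvPolynomial.degreeOf_C]
    omega
  have hall : ∀ l, q.degreeOf l = 0 := fun l => by
    by_cases hil : i = l
    · exact hdeg j l c (fun h => hij (hil.trans h.symm)) hj
    · exact hdeg i l b hil hi
  have hvars : q.vars = ∅ := by
    refine Finset.eq_empty_of_forall_notMem fun l hl => ?_
    have := hall l
    rw [MvPolynomial.degreeOf_def, Multiset.count_eq_zero] at this
    exact this (by simpa [MvPolynomial.vars_def] using hl)
  rw [MvPolynomial.vars_eq_empty_iff_eq_C] at hvars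
  rw [hvars, MvPolynomial.isUnit_iff_eq_C_of_isReduced]
  refine ⟨_, isUnit_iff_ne_zero.mpr fun h => ?_, rfl⟩
  rw [h, map_zero] at hvars
  rw [hvars, zero_dvd_iff] at hi
  exact hne _ _ hi

/-- A prime ideal containing all `x_j ^ d` contains every invariant without constant term. -/
theorem mem_of_purePower_mem (hd : d ≠ 0) (P : Ideal (CoordRing d n)) [P.IsPrime]
    (hP : ∀ j, purePower hd j ∈ P) (a : CoordRing d n)
    (ha : MvPolynomial.coeff 0 (a : MvPolynomial (Fin n) ℂ) = 0) : a ∈ P := by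
  rw [exists_eq_sum_invMonomial hd a]
  refine sum_mem fun m _ => ?_
  have hm : (m : Fin n →₀ ℕ) ≠ 0 := fun h =>
    MvPolynomial.mem_support_iff.mp m.2 (by rw [h, ha])
  obtain ⟨j, hj⟩ := Finsupp.ne_iff.mp hm
  refine Submodule.smul_of_tower_mem P _ (Ideal.IsPrime.mem_of_pow_mem ‹_› d ?_)
  rw [invMonomial_pow]
  exact Ideal.mem_of_dvd _ (Finset.dvd_prod_of_mem _ (Finset.mem_univ j))
    (Ideal.pow_mem_of_mem _ (hP j) _ (Nat.pos_of_ne_zero hj))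

/-- Pulling back the ideal of a prime factor `p` of `q` gives a prime ideal of invariants containing
every `x_j^d`, hence all invariants without constant term. So modulo `p` the image of every
invariant is constant, and as `g` is onto, each `x_i^d` is constant modulo `p`. -/
theorem isUnit_of_forall_dvd (hd : d ≠ 0) (hn : 2 ≤ n) (g : CoordRing d n ≃ₐ[ℂ] CoordRing d n)
    (q : MvPolynomial (Fin n) ℂ)
    (hq : ∀ j, q ∣ (g (purePower hd j) : MvPolynomial (Fin n) ℂ)) : IsUnit q := by
  by_contra hu
  have hq0 : q ≠ 0 := by
    rintro rfl
    have h := zero_dvd_iff.mp (hq ⟨0, by omega⟩)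
    exact purePower_ne_zero hd _ ((map_eq_zero_iff g g.injective).mp (Subtype.ext h))
  obtain ⟨p, hp, hpq⟩ := WfDvdMonoid.exists_irreducible_factor hu hq0
  have hp' : Prime p := UniqueFactorizationMonoid.irreducible_iff_prime.mp hp
  have : (Ideal.span {p}).IsPrime := (Ideal.span_singleton_prime hp'.ne_zero).mpr hp'
  let P : Ideal (CoordRing d n) :=
    (Ideal.span {p}).comap ((CoordRing d n).val.comp (g : CoordRing d n →ₐ[ℂ] CoordRing d n))
  have hP : ∀ a, a ∈ P ↔ p ∣ (g a : MvPolynomial (Fin n) ℂ) := fun a =>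
    Ideal.mem_span_singleton
  have : P.IsPrime := Ideal.comap_isPrime _ _
  have key : ∀ i : Fin n, ∃ c : ℂ, p ∣ MvPolynomial.X i ^ d - MvPolynomial.C c := by
    intro i
    let u := g.symm (purePower hd i)
    refine ⟨MvPolynomial.coeff 0 (u : MvPolynomial (Fin n) ℂ), ?_⟩
    have h := mem_of_purePower_mem hd P (fun j => (hP _).mpr (hpq.trans (hq j)))
      (u - algebraMap ℂ _ (MvPolynomial.coeff 0 (u : MvPolynomial (Fin n) ℂ))) (by
        change MvPolynomial.coeff 0 ((u : MvPolynomial (Fin n) ℂ) - MvPolynomial.C _) = 0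
        rw [MvPolynomial.coeff_sub, MvPolynomial.coeff_zero_C, sub_self])
    rw [hP, map_sub, AlgEquiv.commutes, AlgEquiv.apply_symm_apply] at h
    exact h
  obtain ⟨b, hb⟩ := key ⟨0, by omega⟩
  obtain ⟨c, hc⟩ := key ⟨1, by omega⟩
  exact hp.not_isUnit (isUnit_of_dvd_X_pow_sub_C (by simp) hd hb hc)

theorem MvPolynomial.exists_pow_eq_of_isUnit {σ : Type*} (hd : d ≠ 0) (u : MvPolynomial σ ℂ)
    (hu : IsUnit u) : ∃ v, v ^ d = u := by
  obtain ⟨r, -, rfl⟩ := MvPolynomial.isUnit_iff_eq_C_of_isReduced.mp hu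
  obtain ⟨z, rfl⟩ := IsAlgClosed.exists_pow_nat_eq r (Nat.pos_of_ne_zero hd)
  exact ⟨MvPolynomial.C z, (map_pow _ _ _).symm⟩

/-- `H` restricts to `g` on the invariants. -/
def Extends (H : MvPolynomial (Fin n) ℂ →ₐ[ℂ] MvPolynomial (Fin n) ℂ)
    (g : CoordRing d n ≃ₐ[ℂ] CoordRing d n) : Prop :=
  ∀ a : CoordRing d n, H a = g a

theorem exists_extends (hd : d ≠ 0) (hn : 2 ≤ n) (g : CoordRing d n ≃ₐ[ℂ] CoordRing d n) :
    ∃ H, Extends H g := by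
  refine exists_aeval_eq hd (MvPolynomial.exists_pow_eq_of_isUnit hd)
    ((CoordRing d n).val.comp (g : CoordRing d n →ₐ[ℂ] CoordRing d n)) ⟨0, by omega⟩ ?_ ?_
  · intro h
    exact purePower_ne_zero hd _ ((map_eq_zero_iff g g.injective).mp (Subtype.ext h))
  · intro p hp
    by_contra! h
    exact hp.not_isUnit (isUnit_of_forall_dvd hd hn g p h)

theorem Extends.comp {H H' : MvPolynomial (Fin n) ℂ →ₐ[ℂ] MvPolynomial (Fin n) ℂ}
    {g g' : CoordRing d n ≃ₐ[ℂ] CoordRing d n} (h : Extends H g) (h' : Extends H' g') :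
    Extends (H.comp H') (g * g') := fun a => by
  rw [AlgHom.comp_apply, h' a, h (g' a)]
  rfl

theorem Extends.map_X_ne_zero (hd : d ≠ 0)
    {H : MvPolynomial (Fin n) ℂ →ₐ[ℂ] MvPolynomial (Fin n) ℂ}
    {g : CoordRing d n ≃ₐ[ℂ] CoordRing d n} (h : Extends H g) (i : Fin n) :
    H (MvPolynomial.X i) ≠ 0 := fun h0 => by
  have h1 := h (purePower hd i)
  change H (MvPolynomial.X i ^ d) = _ at h1
  rw [map_pow, h0, zero_pow hd] at h1
  exact purePower_ne_zero hd _ ((map_eq_zero_iff g g.injective).mp (Subtype.ext h1.symm))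

theorem Extends.eq_scalarHom (hd : d ≠ 0) (hn : 2 ≤ n)
    {H : MvPolynomial (Fin n) ℂ →ₐ[ℂ] MvPolynomial (Fin n) ℂ}
    (h : Extends H (1 : CoordRing d n ≃ₐ[ℂ] CoordRing d n)) :
    ∃ c : ℂ, c ^ d = 1 ∧ H = scalarHom n c := by
  obtain ⟨c, hc, hH⟩ := exists_smul_of_eqOn hd (AlgHom.id ℂ _) H (fun a => (h a).symm)
    ⟨0, by omega⟩ (MvPolynomial.X_ne_zero _)
  exact ⟨c, hc, hH⟩

theorem scalarHom_bijective (hd : d ≠ 0) {c : ℂ} (hc : c ^ d = 1) :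
    Function.Bijective (scalarHom n c) := by
  have hc0 : c ≠ 0 := by rintro rfl; simp [hd] at hc
  exact (scalarAut n (Units.mk0 c hc0)⁻¹).bijective

/-- Composed in either order with a lift of `g⁻¹`, the map lifts the identity, hence is an
invertible scalar multiplication. -/
theorem Extends.bijective (hd : d ≠ 0) (hn : 2 ≤ n)
    {H : MvPolynomial (Fin n) ℂ →ₐ[ℂ] MvPolynomial (Fin n) ℂ}
    {g : CoordRing d n ≃ₐ[ℂ] CoordRing d n} (h : Extends H g) : Function.Bijective H := by
  obtain ⟨H', h'⟩ := exists_extends hd hn g⁻¹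
  obtain ⟨b, hb, hH⟩ := Extends.eq_scalarHom hd hn (mul_inv_cancel g ▸ h.comp h')
  obtain ⟨c, hc, hH'⟩ := Extends.eq_scalarHom hd hn (inv_mul_cancel g ▸ h'.comp h)
  constructor
  · refine Function.Injective.of_comp (f := H') ?_
    rw [← AlgHom.coe_comp, hH']
    exact (scalarHom_bijective hd hc).1
  · refine Function.Surjective.of_comp (g := H') ?_
    rw [← AlgHom.coe_comp, hH]
    exact (scalarHom_bijective hd hb).2

theorem MvPolynomial.coeff_single_one_mul {σ R : Type*} [CommSemiring R] (i : σ)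
    (f g : MvPolynomial σ R) :
    (f * g).coeff (Finsupp.single i 1) =
      f.coeff 0 * g.coeff (Finsupp.single i 1) + f.coeff (Finsupp.single i 1) * g.coeff 0 := by
  classical
  rw [MvPolynomial.coeff_mul, Finsupp.antidiagonal_single, Finset.sum_map]
  simp [Finset.Nat.antidiagonal_succ]

/-- The polynomials whose linear term does not involve `x_i`. -/
def noLinearTerm (n : ℕ) (i : Fin n) : Subalgebra ℂ (MvPolynomial (Fin n) ℂ) where
  carrier := {f | f.coeff (Finsupp.single i 1) = 0}
  mul_mem' {f g} hf hg := by
    rw [Set.mem_ofPred_eq] at *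
    rw [MvPolynomial.coeff_single_one_mul, hf, hg, mul_zero, zero_mul, add_zero]
  add_mem' {f g} hf hg := by
    rw [Set.mem_ofPred_eq] at *
    rw [MvPolynomial.coeff_add, hf, hg, add_zero]
  algebraMap_mem' c := by
    rw [Set.mem_ofPred_eq, MvPolynomial.algebraMap_eq, MvPolynomial.coeff_C, if_neg]
    simp [eq_comm]

/-- Every lift of an automorphism of the quotient commutes with `μ_d`. -/
theorem Extends.comm_scalarHom (hd : d ≠ 0) (hn : 2 ≤ n)
    {H : MvPolynomial (Fin n) ℂ →ₐ[ℂ] MvPolynomial (Fin n) ℂ}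
    {g : CoordRing d n ≃ₐ[ℂ] CoordRing d n} (h : Extends H g) {c : ℂ} (hc : c ^ d = 1) :
    (scalarHom n c).comp H = H.comp (scalarHom n c) := by
  let i : Fin n := ⟨0, by omega⟩
  obtain ⟨b, hb, hH⟩ := exists_smul_of_eqOn hd H ((scalarHom n c).comp H)
    (fun a => by
      rw [AlgHom.comp_apply, h a, (mem_coordRing_iff_scalarHom hd).mp (g a).2 c hc]) i
    (h.map_X_ne_zero hd i)
  rw [hH]
  suffices b = c by rw [this]
  by_contra hbc
  -- The coefficient of `x_i` in `H x_j` is multiplied by `c` on one side and by `b` on the other,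
  -- so it vanishes. The image of `H` then lies in a proper subalgebra, against surjectivity.
  have hlin : ∀ j, H (MvPolynomial.X j) ∈ noLinearTerm n i := by
    intro j
    have h1 := congrArg (MvPolynomial.coeff (Finsupp.single i 1))
      (DFunLike.congr_fun hH (MvPolynomial.X j))
    rw [AlgHom.comp_apply, AlgHom.comp_apply, scalarHom_X, map_smul, coeff_scalarHom,
      MvPolynomial.coeff_smul, Finsupp.degree_single, pow_one, smul_eq_mul] at h1
    by_contra h0
    exact hbc (mul_right_cancel₀ h0 h1.symm)
  have hle : H.range ≤ noLinearTerm n i := by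
    rw [← Algebra.map_top, ← MvPolynomial.adjoin_range_X, AlgHom.map_adjoin, Algebra.adjoin_le_iff]
    rintro _ ⟨_, ⟨j, rfl⟩, rfl⟩
    exact hlin j
  have h2 : MvPolynomial.X i ∈ noLinearTerm n i := hle ((h.bijective hd hn).2 _)
  change (MvPolynomial.X i : MvPolynomial (Fin n) ℂ).coeff (Finsupp.single i 1) = 0 at h2
  simp at h2

theorem Extends.mem_autMu (hd : d ≠ 0) (hn : 2 ≤ n)
    {G : MvPolynomial (Fin n) ℂ ≃ₐ[ℂ] MvPolynomial (Fin n) ℂ}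
    {g : CoordRing d n ≃ₐ[ℂ] CoordRing d n}
    (h : Extends (G : MvPolynomial (Fin n) ℂ →ₐ[ℂ] MvPolynomial (Fin n) ℂ) g) :
    G ∈ AutMu d n := by
  refine Subgroup.mem_centralizer_iff.mpr ?_
  rintro _ ⟨c, hc, rfl⟩
  have hc' : ((c⁻¹ : ℂˣ) : ℂ) ^ d = 1 := by
    simpa using congrArg Units.val ((mem_rootsOfUnity _ _).mp (inv_mem hc))
  exact AlgEquiv.ext fun f => DFunLike.congr_fun (h.comm_scalarHom hd hn hc') f

theorem phi_eq_iff {G : AutMu d n} {g : CoordRing d n ≃ₐ[ℂ] CoordRing d n} :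
    phi d n G = g ↔
      Extends ((G : MvPolynomial (Fin n) ℂ ≃ₐ[ℂ] MvPolynomial (Fin n) ℂ) :
        MvPolynomial (Fin n) ℂ →ₐ[ℂ] MvPolynomial (Fin n) ℂ) g := by
  constructor
  · rintro rfl a
    rfl
  · intro h
    exact AlgEquiv.ext fun a => Subtype.ext (h a)

theorem phi_surjective (hd : d ≠ 0) (hn : 2 ≤ n) : Function.Surjective (phi d n) := by
  intro g
  obtain ⟨H, hH⟩ := exists_extends hd hn g
  exact ⟨⟨AlgEquiv.ofBijective H (hH.bijective hd hn), Extends.mem_autMu hd hn hH⟩,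
    phi_eq_iff.mpr hH⟩

theorem muHom_injective (hn : 2 ≤ n) : Function.Injective (muHom d n) := by
  intro b c h
  have h1 : scalarAut n (b : ℂˣ) = scalarAut n (c : ℂˣ) := congrArg Subtype.val h
  have h2 := DFunLike.congr_fun h1 (MvPolynomial.X ⟨0, by omega⟩)
  change scalarHom n (((b : ℂˣ)⁻¹ : ℂˣ) : ℂ) _ = scalarHom n (((c : ℂˣ)⁻¹ : ℂˣ) : ℂ) _ at h2
  rw [scalarHom_X, scalarHom_X] at h2
  exact Subtype.ext (inv_injective (Units.ext
    (smul_left_injective ℂ (MvPolynomial.X_ne_zero _) h2)))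

theorem ker_phi (hd : d ≠ 0) (hn : 2 ≤ n) : (phi d n).ker = (muHom d n).range := by
  ext G
  rw [MonoidHom.mem_ker, phi_eq_iff]
  constructor
  · intro h
    obtain ⟨c, hc, hG⟩ := h.eq_scalarHom hd hn
    have hc0 : c ≠ 0 := by rintro rfl; simp [hd] at hc
    refine ⟨⟨(Units.mk0 c hc0)⁻¹, inv_mem ((mem_rootsOfUnity _ _).mpr (Units.ext ?_))⟩, ?_⟩
    · simpa using hc
    · refine Subtype.ext (AlgEquiv.ext fun f => ?_)
      refine Eq.trans ?_ (DFunLike.congr_fun hG f).symm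
      change scalarHom n (((Units.mk0 c hc0)⁻¹⁻¹ : ℂˣ) : ℂ) f = _
      rw [inv_inv, Units.val_mk0]
  · rintro ⟨c, rfl⟩ a
    exact a.2 _ ⟨c, c.2, rfl⟩

end Lifting

/-! ### One-parameter groups given by polynomial families -/

namespace AffAut

variable {A : Type*} [CommRing A] [Algebra ℂ A]

/-- Evaluation of a polynomial with coefficients in `A` at a complex number. -/
def evalAt (A : Type*) [CommRing A] [Algebra ℂ A] (s : ℂ) : A[X] →ₐ[ℂ] A :=
  (Polynomial.aeval (algebraMap ℂ A s)).restrictScalars ℂ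

theorem evalAt_eq_sum (s : ℂ) (p : A[X]) :
    evalAt A s p = ∑ i ∈ p.support, s ^ i • p.coeff i := by
  change Polynomial.aeval (algebraMap ℂ A s) p = _
  rw [Polynomial.aeval_def, Polynomial.eval₂_eq_sum, Polynomial.sum]
  refine Finset.sum_congr rfl fun i _ => ?_
  rw [Algebra.algebraMap_self_apply, Algebra.smul_def, map_pow, mul_comm]

theorem evalAt_injective [IsDomain A] {p q : A[X]} (h : ∀ s, evalAt A s p = evalAt A s q) :
    p = q := by
  rw [← sub_eq_zero]
  refine Polynomial.eq_zero_of_infinite_isRoot _ ?_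
  refine Set.Infinite.mono ?_ (Set.infinite_range_of_injective (algebraMap ℂ A).injective)
  rintro _ ⟨s, rfl⟩
  have h1 : evalAt A s (p - q) = 0 := by rw [map_sub, h, sub_self]
  exact h1

theorem exists_polynomial_linearForm (p : A[X]) (l : A →ₗ[ℂ] ℂ) :
    ∃ q : ℂ[X], ∀ s, l (evalAt A s p) = q.eval s := by
  refine ⟨∑ i ∈ p.support, Polynomial.C (l (p.coeff i)) * Polynomial.X ^ i, fun s => ?_⟩
  rw [evalAt_eq_sum, map_sum, Polynomial.eval_finsetSum]
  refine Finset.sum_congr rfl fun i _ => ?_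
  rw [map_smul, smul_eq_mul, Polynomial.eval_mul, Polynomial.eval_C, Polynomial.eval_pow,
    Polynomial.eval_X, mul_comm]

/-- A homomorphism from `ℂ⁺` to `Aut(X)` which is given by a polynomial family of automorphisms and
has a regular left inverse is the parametrization of a one-dimensional unipotent subgroup. -/
theorem isOneDimUnipotent_range (E : Multiplicative ℂ →* (A ≃ₐ[ℂ] A)) (Θ : A →ₐ[ℂ] A[X])
    (hE : ∀ s a, E (Multiplicative.ofAdd s) a = evalAt A s (Θ a)) {V : Submodule ℂ A}
    (hV : Generating V) {r : (A ≃ₐ[ℂ] A) → ℂ} (hr : r ∈ coeffAlgebra A)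
    (hrE : ∀ s, r (E (Multiplicative.ofAdd s)) = s) : IsOneDimUnipotent E.range := by
  have hE' : ∀ s a, (E (Multiplicative.ofAdd s)).symm a = evalAt A (-s) (Θ a) := fun s a => by
    rw [← hE, ofAdd_neg, map_inv]
    rfl
  have hinj : Function.Injective E := fun x y hxy => by
    have h := congrArg r hxy
    rw [← ofAdd_toAdd x, ← ofAdd_toAdd y, hrE, hrE] at h
    exact Multiplicative.toAdd.injective h
  refine ⟨fun W F _ _ => ?_, MonoidHom.ofInjective hinj, ⟨?_, ?_⟩, fun W F _ _ => ⟨r, hr, ?_⟩⟩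
  -- The image is the set of `g` with `g = E(r(g))`; these equations express that, tested on each
  -- `a` by each linear form `l`.
  · refine ⟨{c | ∃ (a : A) (l : A →ₗ[ℂ] ℂ), c = (fun g : A ≃ₐ[ℂ] A => l (g a)) -
      ∑ i ∈ (Θ a).support, l ((Θ a).coeff i) • r ^ i}, ?_, ?_⟩
    · rintro _ ⟨a, l, rfl⟩
      refine sub_mem (Algebra.subset_adjoin ⟨a, l, Or.inl rfl⟩) (sum_mem fun i _ => ?_)
      exact Subalgebra.smul_mem _ (pow_mem hr i) _
    · have hval : ∀ (g : A ≃ₐ[ℂ] A) (a : A) (l : A →ₗ[ℂ] ℂ),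
          ((fun g : A ≃ₐ[ℂ] A => l (g a)) - ∑ i ∈ (Θ a).support, l ((Θ a).coeff i) • r ^ i) g =
          l (g a - evalAt A (r g) (Θ a)) := by
        intro g a l
        rw [Pi.sub_apply, Finset.sum_apply, map_sub, evalAt_eq_sum, map_sum]
        congr 1
        refine Finset.sum_congr rfl fun i _ => ?_
        rw [Pi.smul_apply, Pi.pow_apply, map_smul, smul_eq_mul, smul_eq_mul, mul_comm]
      ext g
      constructor
      · rintro ⟨⟨s, rfl⟩, hg⟩
        refine ⟨hg, ?_⟩
        rintro _ ⟨a, l, rfl⟩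
        rw [hval, ← ofAdd_toAdd s, hrE, hE, sub_self, map_zero]
      · rintro ⟨hg, h⟩
        refine ⟨⟨Multiplicative.ofAdd (r g), AlgEquiv.ext fun a => ?_⟩, hg⟩
        rw [hE, eq_comm, ← sub_eq_zero]
        refine (Module.forall_dual_apply_eq_zero_iff ℂ _).mp fun l => ?_
        rw [← hval]
        exact h _ ⟨a, l, rfl⟩
  · have := hV.1
    let b := Module.finBasis ℂ V
    -- All coefficients in `s` of the orbits of a basis of `V`; this bounds the whole family,
    -- inverses included, since these are the values at `-s`.
    let F : Submodule ℂ A := Submodule.span ℂ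
      (⋃ i, (fun k => (Θ (b i)).coeff k) '' ((Θ (b i)).support : Set ℕ))
    have hF : ∀ s, ∀ v ∈ V, evalAt A s (Θ v) ∈ F := by
      intro s v hv
      have h1 : V ≤ F.comap ((evalAt A s).comp Θ).toLinearMap := by
        intro w hw
        have h2 := b.sum_repr ⟨w, hw⟩
        have h3 : w = ∑ i, b.repr ⟨w, hw⟩ i • (b i : A) := by
          have h4 := congrArg Subtype.val h2
          rw [Submodule.coe_sum] at h4
          exact h4.symm
        rw [h3]
        refine sum_mem fun i _ => Submodule.smul_mem _ _ ?_
        rw [Submodule.mem_comap]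
        change evalAt A s (Θ (b i)) ∈ F
        rw [evalAt_eq_sum]
        refine sum_mem fun k hk => Submodule.smul_mem _ _ (Submodule.subset_span ?_)
        exact Set.mem_iUnion.mpr ⟨i, k, hk, rfl⟩
      exact h1 hv
    refine ⟨V, F, hV, ?_, fun s v hv => ⟨?_, ?_⟩⟩
    · exact FiniteDimensional.span_of_finite ℂ
        (Set.finite_iUnion fun i => (Finset.finite_toSet _).image _)
    · change E (Multiplicative.ofAdd s) v ∈ F
      rw [hE]
      exact hF _ _ hv
    · change (E (Multiplicative.ofAdd s)).symm v ∈ F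
      rw [hE']
      exact hF _ _ hv
  · intro c hc
    change ∃ p : ℂ[X], ∀ s, c (E (Multiplicative.ofAdd s)) = p.eval s
    induction hc using Algebra.adjoin_induction with
    | mem c hc =>
      obtain ⟨a, l, rfl | rfl⟩ := hc
      · obtain ⟨q, hq⟩ := exists_polynomial_linearForm (Θ a) l
        exact ⟨q, fun s => by rw [← hq, ← hE]⟩
      · obtain ⟨q, hq⟩ := exists_polynomial_linearForm (Θ a) l
        exact ⟨q.comp (-Polynomial.X), fun s => by
          rw [Polynomial.eval_comp, Polynomial.eval_neg, Polynomial.eval_X, ← hq, ← hE']⟩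
    | algebraMap z => exact ⟨Polynomial.C z, fun s => by simp⟩
    | add c c' _ _ hc hc' =>
      obtain ⟨p, hp⟩ := hc
      obtain ⟨p', hp'⟩ := hc'
      exact ⟨p + p', fun s => by rw [Pi.add_apply, hp, hp', Polynomial.eval_add]⟩
    | mul c c' _ _ hc hc' =>
      obtain ⟨p, hp⟩ := hc
      obtain ⟨p', hp'⟩ := hc'
      exact ⟨p * p', fun s => by rw [Pi.mul_apply, hp, hp', Polynomial.eval_mul]⟩
  · rintro ⟨_, s, rfl⟩ _
    change Multiplicative.toAdd ((MonoidHom.ofInjective hinj).symm _) = r (E s)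
    rw [← ofAdd_toAdd s, hrE]
    exact congrArg Multiplicative.toAdd ((MonoidHom.ofInjective hinj).symm_apply_apply _)

/-- A morphism `ℂ → Aut(X)` is given by polynomials with coefficients in `O(X)`. -/
theorem IsMorphismFromLine.exists_polynomial {e : ℂ → (A ≃ₐ[ℂ] A)} (he : IsMorphismFromLine e)
    (a : A) : ∃ p : A[X], ∀ s, evalAt A s p = e s a := by
  obtain ⟨⟨V, F, hV, hF, hVF⟩, hpoly⟩ := he
  have ha : a ∈ Algebra.adjoin ℂ (V : Set A) := hV.2 ▸ Algebra.mem_top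
  induction ha using Algebra.adjoin_induction with
  | mem v hv =>
    let b := Module.finBasis ℂ F
    -- Coordinates on `F` extend to linear forms on `A`, so the coordinates of `e s v` are matrix
    -- coefficients and hence polynomial in `s`.
    have hl : ∀ i, ∃ l : A →ₗ[ℂ] ℂ, ∀ x : F, l x = b.coord i x := fun i => by
      obtain ⟨l, hl⟩ := LinearMap.exists_extend (b.coord i)
      exact ⟨l, fun x => DFunLike.congr_fun hl x⟩
    choose l hl using hl
    have hp : ∀ i, ∃ p : ℂ[X], ∀ s, l i (e s v) = p.eval s := fun i =>
      hpoly _ (Algebra.subset_adjoin ⟨v, l i, Or.inl rfl⟩)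
    choose p hp using hp
    refine ⟨∑ i, Polynomial.C (b i : A) * (p i).map (algebraMap ℂ A), fun s => ?_⟩
    have hmem : e s v ∈ F := (hVF s v hv).1
    have h1 : e s v = ∑ i, l i (e s v) • (b i : A) := by
      conv_lhs => rw [show e s v = ((⟨e s v, hmem⟩ : F) : A) from rfl, ← b.sum_repr ⟨e s v, hmem⟩]
      rw [Submodule.coe_sum]
      refine Finset.sum_congr rfl fun i _ => ?_
      rw [Submodule.coe_smul, hl i ⟨e s v, hmem⟩, Module.Basis.coord_apply]
    rw [h1, map_sum]
    refine Finset.sum_congr rfl fun i _ => ?_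
    rw [map_mul, hp, Algebra.smul_def, mul_comm]
    congr 1
    · change Polynomial.aeval (algebraMap ℂ A s) _ = _
      simp [Polynomial.aeval_algebraMap_apply]
    · change Polynomial.aeval (algebraMap ℂ A s) _ = _
      simp
  | algebraMap z =>
    exact ⟨algebraMap ℂ _ z, fun s => by rw [AlgHom.commutes, AlgEquiv.commutes]⟩
  | add x y _ _ hx hy =>
    obtain ⟨p, hp⟩ := hx
    obtain ⟨q, hq⟩ := hy
    exact ⟨p + q, fun s => by rw [map_add, map_add, hp, hq]⟩
  | mul x y _ _ hx hy =>
    obtain ⟨p, hp⟩ := hx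
    obtain ⟨q, hq⟩ := hy
    exact ⟨p * q, fun s => by rw [map_mul, map_mul, hp, hq]⟩

/-- Regular functions on `Aut(X / H)` pull back to regular functions on `Aut^H(X)`. -/
theorem exists_coeffAlgebra_comp_quotientHom (H : Subgroup (A ≃ₐ[ℂ] A))
    {r : (invariants H ≃ₐ[ℂ] invariants H) → ℂ} (hr : r ∈ coeffAlgebra (invariants H)) :
    ∃ r' ∈ coeffAlgebra A, ∀ g : equivariant H, r' g = r (quotientHom H g) := by
  induction hr using Algebra.adjoin_induction with
  | mem c hc =>
    obtain ⟨a, l, hc⟩ := hc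
    obtain ⟨l', hl'⟩ := LinearMap.exists_extend (p := Subalgebra.toSubmodule (invariants H)) l
    have hl : ∀ x : invariants H, l' x = l x := fun x => DFunLike.congr_fun hl' x
    obtain rfl | rfl := hc
    · exact ⟨_, Algebra.subset_adjoin ⟨a, l', Or.inl rfl⟩, fun g => hl (quotientHom H g a)⟩
    · exact ⟨_, Algebra.subset_adjoin ⟨a, l', Or.inr rfl⟩, fun g => hl ((quotientHom H g).symm a)⟩
  | algebraMap z => exact ⟨algebraMap ℂ _ z, Subalgebra.algebraMap_mem _ _, fun g => rfl⟩
  | add c c' _ _ hc hc' =>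
    obtain ⟨p, hp, hpc⟩ := hc
    obtain ⟨p', hp', hpc'⟩ := hc'
    exact ⟨p + p', add_mem hp hp', fun g => by rw [Pi.add_apply, Pi.add_apply, hpc, hpc']⟩
  | mul c c' _ _ hc hc' =>
    obtain ⟨p, hp, hpc⟩ := hc
    obtain ⟨p', hp', hpc'⟩ := hc'
    exact ⟨p * p', mul_mem hp hp', fun g => by rw [Pi.mul_apply, Pi.mul_apply, hpc, hpc']⟩

end AffAut

/-! ### One-dimensional unipotent subgroups lift to affine space -/

section UnipotentLifting

open AffAut

variable {d n : ℕ}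

theorem evalAt_map {A B : Type*} [CommRing A] [Algebra ℂ A] [CommRing B] [Algebra ℂ B]
    (f : A →ₐ[ℂ] B) (s : ℂ) (p : A[X]) :
    evalAt B s (p.map (f : A →+* B)) = f (evalAt A s p) := by
  rw [evalAt_eq_sum, evalAt_eq_sum, map_sum]
  refine Finset.sum_subset_zero_on_sdiff (Polynomial.support_map_subset _ _) ?_ ?_
  · intro i hi
    rw [Finset.mem_sdiff, Polynomial.notMem_support_iff, Polynomial.coeff_map] at hi
    rw [map_smul, ← AlgHom.coe_toRingHom, hi.2, smul_zero]
  · intro i _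
    rw [Polynomial.coeff_map, map_smul]
    rfl

/-- Every value is a nonzero constant, so `p` comes from a polynomial in `ℂ[s]` without zeros, which
is constant. -/
theorem isUnit_of_forall_isUnit_evalAt {σ : Type*} {p : (MvPolynomial σ ℂ)[X]}
    (h : ∀ s, IsUnit (evalAt (MvPolynomial σ ℂ) s p)) : IsUnit p := by
  let c : MvPolynomial σ ℂ →ₐ[ℂ] ℂ := MvPolynomial.aeval fun _ => 0
  let p₁ : ℂ[X] := p.map (c : MvPolynomial σ ℂ →+* ℂ)
  have hp : p = p₁.map (Algebra.ofId ℂ (MvPolynomial σ ℂ) : ℂ →+* MvPolynomial σ ℂ) := by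
    refine evalAt_injective fun s => ?_
    rw [evalAt_map, evalAt_map]
    obtain ⟨r, -, hr⟩ := MvPolynomial.isUnit_iff_eq_C_of_isReduced.mp (h s)
    rw [hr]
    change MvPolynomial.C r = MvPolynomial.C (MvPolynomial.aeval _ (MvPolynomial.C r))
    rw [MvPolynomial.aeval_C]
    rfl
  have hdeg : p₁.degree = 0 := by
    by_contra h0
    obtain ⟨s, hs⟩ := IsAlgClosed.exists_root p₁ h0
    have h1 := h s
    rw [hp, evalAt_map, show evalAt ℂ s p₁ = 0 from hs, map_zero] at h1
    exact not_isUnit_zero h1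
  rw [hp]
  exact (Polynomial.isUnit_iff_degree_eq_zero.mpr hdeg).map (Polynomial.mapRingHom _)

/-- A polynomial family of automorphisms of the quotient lifts to a polynomial family of
endomorphisms of affine space. -/
theorem exists_extends_family (hd : d ≠ 0) (hn : 2 ≤ n)
    {e : ℂ → (CoordRing d n ≃ₐ[ℂ] CoordRing d n)} (he : IsMorphismFromLine e) :
    ∃ Θ : MvPolynomial (Fin n) ℂ →ₐ[ℂ] (MvPolynomial (Fin n) ℂ)[X],
      ∀ s, Extends ((evalAt _ s).comp Θ) (e s) := by
  -- Polynomial families embed into arbitrary families. The family `e` is a homomorphism `γ` into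
  -- the latter whose values are polynomial, so it factors through `ι`.
  let ι : (MvPolynomial (Fin n) ℂ)[X] →ₐ[ℂ] (ℂ → MvPolynomial (Fin n) ℂ) :=
    AlgHom.pi fun s => evalAt _ s
  have hι : Function.Injective ι := fun p q h => evalAt_injective fun s => congrFun h s
  let γ : CoordRing d n →ₐ[ℂ] (ℂ → MvPolynomial (Fin n) ℂ) :=
    AlgHom.pi fun s => (CoordRing d n).val.comp (e s : CoordRing d n →ₐ[ℂ] CoordRing d n)
  have hγ : ∀ a, γ a ∈ ι.range := fun a => by
    obtain ⟨p, hp⟩ := he.exists_polynomial a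
    refine ⟨p.map ((CoordRing d n).val : CoordRing d n →+* MvPolynomial (Fin n) ℂ), ?_⟩
    funext s
    change evalAt _ s _ = (e s a : MvPolynomial (Fin n) ℂ)
    rw [evalAt_map, hp]
    rfl
  let θ : CoordRing d n →ₐ[ℂ] (MvPolynomial (Fin n) ℂ)[X] :=
    ((AlgEquiv.ofInjective ι hι).symm : ι.range →ₐ[ℂ] _).comp (γ.codRestrict ι.range hγ)
  have hθ : ∀ s a, evalAt _ s (θ a) = (e s a : MvPolynomial (Fin n) ℂ) := fun s a => by
    have h : ι (θ a) = γ a := congrArg Subtype.val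
      ((AlgEquiv.ofInjective ι hι).apply_symm_apply (γ.codRestrict ι.range hγ a))
    exact congrFun h s
  obtain ⟨Θ, hΘ⟩ := exists_aeval_eq hd (fun u hu => by
      obtain ⟨r, hr, rfl⟩ := Polynomial.isUnit_iff.mp hu
      obtain ⟨v, rfl⟩ := MvPolynomial.exists_pow_eq_of_isUnit hd r hr
      exact ⟨Polynomial.C v, (map_pow _ _ _).symm⟩) θ ⟨0, by omega⟩ (fun h0 => by
      have h := hθ 0 (purePower hd ⟨0, by omega⟩)
      rw [h0, map_zero] at h
      exact purePower_ne_zero hd _ ((map_eq_zero_iff _ (e 0).injective).mp (Subtype.ext h.symm)))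
    -- A common prime divisor would specialise at each `s` to a common divisor for `e s`, that is,
    -- to a unit, and so would itself be a unit.
    (fun p hp => by
      by_contra! h
      refine hp.not_isUnit (isUnit_of_forall_isUnit_evalAt fun s => ?_)
      refine isUnit_of_forall_dvd hd hn (e s) _ fun j => ?_
      rw [← hθ]
      exact map_dvd (evalAt _ s) (h j))
  exact ⟨Θ, fun s a => by rw [AlgHom.comp_apply, hΘ, hθ]⟩

theorem extends_scalarHom (hd : d ≠ 0) {c : ℂ} (hc : c ^ d = 1) :
    Extends (scalarHom n c) (1 : CoordRing d n ≃ₐ[ℂ] CoordRing d n) := fun a =>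
  (mem_coordRing_iff_scalarHom hd).mp a.2 c hc

/-- An algebraic one-parameter group of automorphisms of the quotient lifts to one of affine
space. -/
theorem exists_extends_action (hd : d ≠ 0) (hn : 2 ≤ n)
    (e : Multiplicative ℂ →* (CoordRing d n ≃ₐ[ℂ] CoordRing d n))
    (he : IsMorphismFromLine fun s => e (Multiplicative.ofAdd s)) :
    ∃ Θ : MvPolynomial (Fin n) ℂ →ₐ[ℂ] (MvPolynomial (Fin n) ℂ)[X],
      (∀ s, Extends ((evalAt _ s).comp Θ) (e (Multiplicative.ofAdd s))) ∧
      (evalAt _ 0).comp Θ = AlgHom.id ℂ _ ∧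
      ∀ s t, ((evalAt _ s).comp Θ).comp ((evalAt _ t).comp Θ) = (evalAt _ (s + t)).comp Θ := by
  let i : Fin n := ⟨0, by omega⟩
  obtain ⟨Θ₀, hΘ₀⟩ := exists_extends_family hd hn he
  have hΘ₀0 := hΘ₀ 0
  rw [ofAdd_zero, map_one] at hΘ₀0
  obtain ⟨c, hc, hcΘ⟩ := hΘ₀0.eq_scalarHom hd hn
  have hc0 : c ≠ 0 := by rintro rfl; simp [hd] at hc
  -- The lift at `s = 0` is multiplication by `c`; dividing it out makes the family start at the
  -- identity.
  let Θ := Θ₀.comp (scalarHom n c⁻¹)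
  have hΘ : ∀ s, Extends ((evalAt _ s).comp Θ) (e (Multiplicative.ofAdd s)) := fun s => by
    have h := (hΘ₀ s).comp (extends_scalarHom hd (c := c⁻¹) (by rw [inv_pow, hc, inv_one]))
    rwa [mul_one, AlgHom.comp_assoc] at h
  have hzero : (evalAt _ 0).comp Θ = AlgHom.id ℂ _ := by
    rw [← AlgHom.comp_assoc, hcΘ, scalarHom_comp, mul_inv_cancel₀ hc0, scalarHom_one]
  refine ⟨Θ, hΘ, hzero, fun s t => ?_⟩
  -- The shift of the parameter `s ↦ s + t`.
  let τ : (MvPolynomial (Fin n) ℂ)[X] →ₐ[ℂ] (MvPolynomial (Fin n) ℂ)[X] :=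
    (Polynomial.aeval (Polynomial.X + Polynomial.C (MvPolynomial.C t))).restrictScalars ℂ
  have hτ : ∀ s p, evalAt _ s (τ p) = evalAt _ (s + t) p := fun s p => by
    change Polynomial.aeval (MvPolynomial.C s) (Polynomial.aeval _ p) =
      Polynomial.aeval (MvPolynomial.C (s + t)) p
    rw [← Polynomial.aeval_algHom_apply]
    simp
  -- Comparing the two sides of the group law as maps into `ℂ[x_1, …, x_n][s]` makes the defect `b`
  -- independent of `s`; the value at `s = 0` then shows `b = 1`.
  obtain ⟨b, -, hb⟩ := exists_smul_of_eqOn hd (τ.comp Θ) (Θ.comp ((evalAt _ t).comp Θ))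
    (fun a => evalAt_injective fun s => by
      have h1 := ((hΘ s).comp (hΘ t)) a
      rw [← map_mul, ← ofAdd_add, ← hΘ (s + t) a] at h1
      rw [AlgHom.comp_apply, hτ]
      exact h1.symm) i (fun h0 => (hΘ t).map_X_ne_zero hd i (by
        have h1 := congrArg (evalAt _ 0) h0
        rw [AlgHom.comp_apply, hτ, zero_add, map_zero] at h1
        exact h1))
  have hev : ∀ s, ((evalAt _ s).comp Θ).comp ((evalAt _ t).comp Θ) =
      ((evalAt _ (s + t)).comp Θ).comp (scalarHom n b) := fun s => by
    rw [AlgHom.comp_assoc, hb]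
    refine AlgHom.ext fun f => ?_
    exact hτ s _
  have hb1 : b = 1 := by
    have h := DFunLike.congr_fun (hev 0) (MvPolynomial.X i)
    rw [hzero, zero_add, AlgHom.id_comp, AlgHom.comp_apply _ (scalarHom n b), scalarHom_X,
      map_smul] at h
    refine smul_left_injective ℂ ((hΘ t).map_X_ne_zero hd i) ?_
    change b • _ = (1 : ℂ) • _
    rw [← h, one_smul]
  rw [hev, hb1, scalarHom_one, AlgHom.comp_id]

theorem generating_span_range_X (n : ℕ) :
    Generating (Submodule.span ℂ (Set.range (MvPolynomial.X : Fin n → MvPolynomial (Fin n) ℂ))) :=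
  ⟨FiniteDimensional.span_of_finite ℂ (Set.finite_range _), by
    rw [Algebra.adjoin_span, MvPolynomial.adjoin_range_X]⟩

theorem exists_isOneDimUnipotent_map_eq (hd : d ≠ 0) (hn : 2 ≤ n)
    (U : Subgroup (CoordRing d n ≃ₐ[ℂ] CoordRing d n)) (hU : IsOneDimUnipotent U) :
    ∃ U' : Subgroup (AutMu d n),
      IsOneDimUnipotent (U'.map (AutMu d n).subtype) ∧ U'.map (phi d n) = U := by
  obtain ⟨-, e, he, hline⟩ := hU
  let ε : Multiplicative ℂ →* (CoordRing d n ≃ₐ[ℂ] CoordRing d n) :=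
    U.subtype.comp e.toMonoidHom
  obtain ⟨Θ, hΘ, hzero, hadd⟩ := exists_extends_action hd hn ε he
  let E : Multiplicative ℂ →* (MvPolynomial (Fin n) ℂ ≃ₐ[ℂ] MvPolynomial (Fin n) ℂ) :=
    { toFun := fun s => AlgEquiv.ofAlgHom ((evalAt _ (Multiplicative.toAdd s)).comp Θ)
        ((evalAt _ (-Multiplicative.toAdd s)).comp Θ)
        (by rw [hadd, add_neg_cancel, hzero]) (by rw [hadd, neg_add_cancel, hzero])
      map_one' := AlgEquiv.ext fun f => DFunLike.congr_fun hzero f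
      map_mul' := fun s t => AlgEquiv.ext fun f =>
        (DFunLike.congr_fun (hadd (Multiplicative.toAdd s) (Multiplicative.toAdd t)) f).symm }
  let E' : Multiplicative ℂ →* AutMu d n := E.codRestrict (AutMu d n) fun s =>
    Extends.mem_autMu hd hn (hΘ (Multiplicative.toAdd s))
  have hphi : (phi d n).comp E' = ε := MonoidHom.ext fun s => phi_eq_iff.mpr (hΘ _)
  refine ⟨E'.range, ?_, ?_⟩
  · rw [MonoidHom.map_range]
    change IsOneDimUnipotent E.range
    -- All of `U` lies in this one piece, so a single regular function `r` gives the coordinate on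
    -- the whole of `U`.
    obtain ⟨V, F, hV, hF, hVF⟩ := he.1
    obtain ⟨r, hr, hrU⟩ := hline V F hV hF
    obtain ⟨r', hr', hr'r⟩ := exists_coeffAlgebra_comp_quotientHom (muSubgroup d n) hr
    refine isOneDimUnipotent_range E Θ (fun s a => rfl) (generating_span_range_X n) hr'
      fun s => ?_
    have h1 := hrU (e (Multiplicative.ofAdd s)) (hVF s)
    beta_reduce at h1
    rw [MulEquiv.symm_apply_apply, toAdd_ofAdd] at h1
    refine Eq.trans ?_ h1.symm
    exact (hr'r (E' (Multiplicative.ofAdd s))).trans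
      (congrArg r (DFunLike.congr_fun hphi (Multiplicative.ofAdd s)))
  · rw [MonoidHom.map_range, hphi]
    ext g
    constructor
    · rintro ⟨s, rfl⟩
      exact (e s).2
    · intro hg
      exact ⟨e.symm ⟨g, hg⟩, congrArg Subtype.val (e.apply_symm_apply ⟨g, hg⟩)⟩

end UnipotentLifting
end

theorem proposition3p3 (d n : ℕ) (hd : 1 < d) (hn : 2 ≤ n) :
    Function.Surjective (phi d n) ∧
    (Function.Injective (muHom d n) ∧ (phi d n).ker = (muHom d n).range) ∧
    ∀ U : Subgroup (CoordRing d n ≃ₐ[ℂ] CoordRing d n), AffAut.IsOneDimUnipotent U →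
      ∃ U' : Subgroup (AutMu d n),
        AffAut.IsOneDimUnipotent (U'.map (AutMu d n).subtype) ∧ U'.map (phi d n) = U := by
  have hd0 : d ≠ 0 := by omega
  exact ⟨phi_surjective hd0 hn, ⟨muHom_injective hn, ker_phi hd0 hn⟩,
    exists_isOneDimUnipotent_map_eq hd0 hn⟩
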